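/- Fix a finite set $G$ of elementary quantum gates (each a unitary on a fixed finite number of qubits; for instance a finite universal gate set). A size-$s$ quantum distinguisher on $m$ input qubits consists of some number of ancilla qubits initialized to $|0\rangle$, a sequence of at most $s$ gates from $G$, each applied to distinct qubits chosen among the input and ancilla qubits, and a designated qubit whose final measurement in the computational basis is the output bit. An $m$-qubit state $\rho$ is $(s,\varepsilon)$-quantum-pseudorandom if $|\Pr[D(\rho)=1]-\Pr[D(2^{-m}I)=1]|\le\varepsilon$ for every size-$s$ quantum distinguisher $D$. Theorem (existence of pseudorandom pure states via random sign vectors). There are constants $C,c>0$, depending only on $G$, such that the following holds for all $s\in\mathbb N$, all $\varepsilon>0$ and every $m\in\mathbb N$ with $m\ge C\log_2(s/\varepsilon)$ (every $m\in\mathbb N$ if $s=0$); in particular it holds for some $m=O(\log(s/\varepsilon))$. If $(\alpha_1,\dots,\alpha_{2^m})$ is sampled uniformly from $\{-2^{-m/2},2^{-m/2}\}^{2^m}$ and $|\psi\rangle=\sum_i\alpha_i|i\rangle$, where $|i\rangle$ runs over the computational basis, then with probability at least $1-2^{-c\varepsilon^2 2^m}$ the operator $\rho=|\psi\rangle\langle\psi|$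 is an $(s,\varepsilon)$-quantum-pseudorandom pure state. (For fixed $\varepsilon$ this probability is $1-2^{-\Omega(2^m)}$.) -/

import Mathlib

open scoped Kronecker

namespace QCircuit

/-- Labels of the computational basis of the qubits `W`: the state space is `ℂ^(Bits W)`. -/
abbrev Bits (W : Type) : Type := W → Fin 2

/-- Operators on the state space of the qubits `W`, in the computational basis. -/
abbrev Op (W : Type) : Type := Matrix (Bits W) (Bits W) ℂ

/-- An elementary gate: a number `k` of qubits and a unitary operator on `k` qubits. -/
abbrev ElementaryGate : Type := Σ k : ℕ, Matrix.unitaryGroup (Bits (Fin k)) ℂ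

/-- A finite set of elementary gates. -/
abbrev GateSet : Type := Finset ElementaryGate

/-- A gate of `G` together with the (ordered, pairwise distinct) wires of `W` it is applied to. -/
structure PlacedGate (G : GateSet) (W : Type) where
  gate : ElementaryGate
  mem : gate ∈ G
  wires : Fin gate.1 ↪ W

/-- The operator on all qubits `W` that acts as the gate on its wires and as the identity on the
remaining qubits. -/
noncomputable def PlacedGate.toOp {G : GateSet} {W : Type} (p : PlacedGate G W) : Op W :=
  open Classical in
  Matrix.of fun x y =>
    if ∀ w, w ∉ Set.range p.wires → x w = y w then
      p.gate.2.1 (fun j => x (p.wires j)) (fun j => y (p.wires j))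
    else 0

/-- A quantum distinguisher on `m` input qubits over the gate set `G`: a number of ancilla qubits,
a sequence of gates on the input and ancilla qubits, and the qubit whose measurement in the
computational basis gives the output bit. -/
structure Distinguisher (G : GateSet) (m : ℕ) where
  ancillas : ℕ
  gates : List (PlacedGate G (Fin m ⊕ Fin ancillas))
  out : Fin m ⊕ Fin ancillas

namespace Distinguisher

variable {G : GateSet} {m : ℕ}

/-- The size is the number of elementary gates. -/
def size (D : Distinguisher G m) : ℕ := D.gates.length

/-- The unitary `U₁ U₂ ⋯ Uₛ` of the circuit. -/
noncomputable def unitary (D : Distinguisher G m) : Op (Fin m ⊕ Fin D.ancillas) :=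
  (D.gates.map PlacedGate.toOp).prod

/-- The projector `|1⟩⟨1|` on the output qubit, tensored with the identity on the others. -/
def proj (D : Distinguisher G m) : Op (Fin m ⊕ Fin D.ancillas) :=
  Matrix.diagonal fun x => if x D.out = 1 then 1 else 0

/-- The initial state `ρ ⊗ |0⋯0⟩⟨0⋯0|` of the work space on input `ρ`. -/
def initial (D : Distinguisher G m) (ρ : Op (Fin m)) : Op (Fin m ⊕ Fin D.ancillas) :=
  (ρ ⊗ₖ (Matrix.single 0 0 1 : Op (Fin D.ancillas))).submatrix
    (Equiv.sumArrowEquivProdArrow _ _ _) (Equiv.sumArrowEquivProdArrow _ _ _)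

/-- The probability that the distinguisher outputs `1` on input `ρ`. -/
noncomputable def acceptProb (D : Distinguisher G m) (ρ : Op (Fin m)) : ℝ :=
  (Matrix.trace (D.proj * (D.unitary * D.initial ρ * D.unitary.conjTranspose))).re

end Distinguisher

/-- `(s, ε)`-quantum-indistinguishability of two states on `m` qubits, ancillas starting in `|0⟩`. -/
def Indistinguishable (G : GateSet) (s : ℕ) (ε : ℝ) {m : ℕ} (ρ σ : Op (Fin m)) : Prop :=
  ∀ D : Distinguisher G m, D.size ≤ s → |D.acceptProb ρ - D.acceptProb σ| ≤ ε

/-- The maximally mixed state on `m` qubits. -/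
noncomputable def maximallyMixed (m : ℕ) : Op (Fin m) := ((2 : ℂ) ^ m)⁻¹ • (1 : Op (Fin m))

/-- `(s, ε)`-quantum-pseudorandomness. -/
def Pseudorandom (G : GateSet) (s : ℕ) (ε : ℝ) {m : ℕ} (ρ : Op (Fin m)) : Prop :=
  Indistinguishable G s ε ρ (maximallyMixed m)

/-- The rank-one operator `|ψ⟩⟨ψ|`. -/
def ketbra {m : ℕ} (ψ : Bits (Fin m) → ℂ) : Op (Fin m) := Matrix.vecMulVec ψ (star ψ)

/-- Pure states: `|ψ⟩⟨ψ|` for a unit vector `ψ`. -/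
def IsPureState {m : ℕ} (ρ : Op (Fin m)) : Prop :=
  ∃ ψ : Bits (Fin m) → ℂ, star ψ ⬝ᵥ ψ = 1 ∧ ρ = ketbra ψ

/-- Choices of `2 ^ m` signs, one for each computational basis vector of `m` qubits. -/
abbrev Signs (m : ℕ) : Type := Bits (Fin m) → ℤˣ

/-- The vector with amplitudes `± 2 ^ (-m / 2)` and the given signs. -/
noncomputable def signVector {m : ℕ} (z : Signs m) : Bits (Fin m) → ℂ :=
  fun x => (((z x : ℤ) : ℝ) * (2 : ℝ) ^ (-(m : ℝ) / 2) : ℝ)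

/-- The probability of an event when the `2 ^ m` signs are uniformly random. -/
noncomputable def signProb {m : ℕ} (E : Signs m → Prop) : ℝ :=
  open Classical in
  ((Finset.univ.filter E).card : ℝ) / (Fintype.card (Signs m) : ℝ)

end QCircuit

namespace QCircuit

open scoped ComplexOrder

/-! In the Heisenberg picture a distinguisher is an effect `0 ≤ M ≤ 1` on the input qubits. With `N
= 2 ^ m`, it accepts the sign vector `z` with probability `zᵀ(Re M)z / N` and the maximally mixed
state with probability `tr (Re M) / N`. So the advantage is the deviation of a Rademacher chaos from
its mean, divided by `N`.

The chaos concentrates because its exponential moments are at most the Gaussian ones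
(`sum_exp_quad_mul_sqrt_det_le`): signs are replaced by Gaussians one at a time, and integrating a
Gaussian out of a quadratic form leaves a Schur complement. A determinant estimate and Markov's
inequality then bound each tail by `exp (-ε² N / 8)`.

A circuit of size `s` touches `O(s)` wires, so only `exp (O(s² m))` effects occur
(`exists_finset_effects`, `two_mul_count_le`). Once `m ≥ C log₂ (s / ε)`, this count costs at most
half of the exponent in the union bound. -/

/-- The value of the quadratic form with matrix `A` at `v`. -/
def quad {ι : Type} [Fintype ι] (A : Matrix ι ι ℝ) (v : ι → ℝ) : ℝ := ∑ i, ∑ j, v i * A i j * v j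

/-- Signs as real numbers. -/
def realSign {ι : Type} (z : ι → ℤˣ) : ι → ℝ := fun i => ((z i : ℤ) : ℝ)

theorem realSign_mul_self {ι : Type} (z : ι → ℤˣ) (i : ι) : realSign z i * realSign z i = 1 := by
  rcases Int.units_eq_one_or (z i) with h | h <;> simp [realSign, h]

/-! ### Real quadratic forms at sign vectors. -/

section Quad

variable {ι : Type} [Fintype ι]

theorem dotProduct_mulVec_eq_quad (A : Matrix ι ι ℝ) (v : ι → ℝ) :
    star v ⬝ᵥ (A.mulVec v) = quad A v := by
  simp [quad, dotProduct, Matrix.mulVec, Finset.mul_sum, mul_assoc]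

theorem quad_nonneg {A : Matrix ι ι ℝ} (hA : A.PosSemidef) (v : ι → ℝ) : 0 ≤ quad A v := by
  rw [← dotProduct_mulVec_eq_quad]
  exact hA.dotProduct_mulVec_nonneg v

theorem quad_sub (A B : Matrix ι ι ℝ) (v : ι → ℝ) : quad (A - B) v = quad A v - quad B v := by
  simp [quad, mul_sub, sub_mul, Finset.sum_sub_distrib]

theorem quad_smul (c : ℝ) (A : Matrix ι ι ℝ) (v : ι → ℝ) : quad (c • A) v = c * quad A v := by
  simp only [quad, Matrix.smul_apply, smul_eq_mul, Finset.mul_sum]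
  exact Finset.sum_congr rfl fun i _ => Finset.sum_congr rfl fun j _ => by ring

theorem quad_one [DecidableEq ι] (z : ι → ℤˣ) : quad 1 (realSign z) = Fintype.card ι := by
  simp [quad, Matrix.one_apply, realSign_mul_self]

end Quad

/-! ### Eliminating one coordinate, and comparison of Rademacher with Gaussian moments. -/

/-- The Schur complement of the `none` entry. -/
noncomputable def schurNone {κ : Type} (P : Matrix (Option κ) (Option κ) ℝ) : Matrix κ κ ℝ :=
  Matrix.of fun i j => P (some i) (some j) - P (some i) none * P none (some j) / P none none

section Schur

variable {κ : Type} [Fintype κ] {P : Matrix (Option κ) (Option κ) ℝ}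

theorem quad_option (hP : P.IsHermitian) (v : Option κ → ℝ) :
    quad P v = P none none * v none ^ 2 + 2 * v none * ∑ j, P none (some j) * v (some j)
      + ∑ i, ∑ j, v (some i) * P (some i) (some j) * v (some j) := by
  have hs : ∀ i, P (some i) none = P none (some i) := fun i => by
    simpa using hP.apply none (some i)
  simp only [quad, Fintype.sum_option, Finset.sum_add_distrib, hs, Finset.mul_sum]
  have h1 : ∑ i, v none * P none (some i) * v (some i)
      = ∑ i, v none * (P none (some i) * v (some i)) :=
    Finset.sum_congr rfl fun i _ => by ring
  have h2 : ∑ i, v (some i) * P none (some i) * v none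
      = ∑ i, v none * (P none (some i) * v (some i)) :=
    Finset.sum_congr rfl fun i _ => by ring
  have h3 : ∑ i, 2 * v none * (P none (some i) * v (some i))
      = 2 * ∑ i, v none * (P none (some i) * v (some i)) := by
    rw [Finset.mul_sum]
    exact Finset.sum_congr rfl fun i _ => by ring
  rw [h1, h2, h3]
  ring

theorem quad_schurNone (hP : P.IsHermitian) (v : κ → ℝ) :
    quad (schurNone P) v = (∑ i, ∑ j, v i * P (some i) (some j) * v j)
      - (∑ j, P none (some j) * v j) ^ 2 / P none none := by
  have hs : ∀ i, P (some i) none = P none (some i) := fun i => by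
    simpa using hP.apply none (some i)
  rw [pow_two, Finset.sum_mul_sum]
  simp only [quad, schurNone, Matrix.of_apply, hs, Finset.sum_div, ← Finset.sum_sub_distrib]
  exact Finset.sum_congr rfl fun i _ => Finset.sum_congr rfl fun j _ => by ring

theorem schurNone_posDef (hP : P.PosDef) : (schurNone P).PosDef := by
  have hp : 0 < P none none := hP.diag_pos
  refine Matrix.PosDef.of_dotProduct_mulVec_pos ?_ ?_
  · ext i j
    have h1 : P (some j) (some i) = P (some i) (some j) := by
      simpa using hP.isHermitian.apply (some i) (some j)
    have hs : ∀ i, P (some i) none = P none (some i) := fun i => by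
      simpa using hP.isHermitian.apply none (some i)
    simp [schurNone, h1, hs, mul_comm]
  · intro v hv
    rw [dotProduct_mulVec_eq_quad, quad_schurNone hP.isHermitian]
    set t := ∑ j, P none (some j) * v j with ht
    -- This `none` coordinate minimizes the form of `P` with `v` fixed, and the minimum is the value
    -- of the Schur complement at `v`.
    let w : Option κ → ℝ := fun o => o.elim (-t / P none none) v
    have hw : w ≠ 0 := fun h => hv (funext fun i => congrFun h (some i))
    have h := hP.dotProduct_mulVec_pos hw
    rw [dotProduct_mulVec_eq_quad, quad_option hP.isHermitian] at h
    simp only [w, Option.elim, ← ht] at h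
    have e : P none none * (-t / P none none) ^ 2 + 2 * (-t / P none none) * t
        = - (t ^ 2 / P none none) := by
      field_simp
      ring
    linarith

theorem det_eq_mul_det_schurNone [DecidableEq κ] (hp : P none none ≠ 0) :
    P.det = P none none * (schurNone P).det := by
  let e : κ ⊕ Unit ≃ Option κ := (Equiv.optionEquivSumPUnit κ).symm
  rw [← Matrix.det_submatrix_equiv_self e P, ← Matrix.fromBlocks_toBlocks (P.submatrix e e)]
  have hD : (P.submatrix e e).toBlocks₂₂ = Matrix.diagonal fun _ => P none none := by
    ext i j
    simp [Matrix.toBlocks₂₂, e]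
  have hu : IsUnit (P.submatrix e e).toBlocks₂₂ := by
    rw [hD, Matrix.isUnit_iff_isUnit_det]
    simpa using hp
  let := hu.invertible
  rw [Matrix.det_fromBlocks₂₂, Matrix.invOf_eq_nonsing_inv]
  congr 1
  · rw [hD]; simp
  · congr 1
    ext i j
    have hinv : (Matrix.diagonal fun _ : Unit => P none none)⁻¹
        = Matrix.diagonal fun _ => (P none none)⁻¹ :=
      Matrix.inv_eq_right_inv (by simp [Matrix.diagonal_mul_diagonal, hp])
    rw [hD, hinv]
    simp [Matrix.mul_apply, Matrix.toBlocks₁₁, Matrix.toBlocks₁₂, Matrix.toBlocks₂₁, e, schurNone]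
    ring

end Schur

theorem sum_signs_option {κ : Type} [Fintype κ] [DecidableEq κ] [DecidableEq (Option κ)]
    (f : (Option κ → ℤˣ) → ℝ) :
    ∑ z, f z = ∑ z : κ → ℤˣ,
      (f (fun o => o.elim 1 z) + f (fun o => o.elim (-1) z)) := by
  have h := Fintype.sum_equiv (Equiv.piOptionEquivProd (α := κ) (β := fun _ => ℤˣ)).symm
    (fun p => f ((Equiv.piOptionEquivProd (α := κ) (β := fun _ => ℤˣ)).symm p)) f (fun _ => rfl)
  rw [← h, Fintype.sum_prod_type, UnitsInt.univ, Finset.sum_pair (by decide),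
    ← Finset.sum_add_distrib]
  refine Finset.sum_congr rfl fun z _ => ?_
  congr 2 <;> (ext o; cases o <;> simp [Equiv.piOptionEquivProd])

/-- The one-variable comparison: a standard Gaussian in place of the sign would give exactly `exp
(t² / (2p)) / √p`. It follows from `√p ≤ exp ((p - 1) / 2)` and `cosh t ≤ exp (t² / 2)`; the second
needs `p ≤ 1` to be weakened to the stated exponent. -/
theorem exp_mul_cosh_le {p t : ℝ} (hp : 0 < p) (hp1 : p ≤ 1) :
    Real.exp ((1 - p) / 2) * Real.cosh t * √p ≤ Real.exp (t ^ 2 / (2 * p)) := by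
  have h1 : Real.exp ((1 - p) / 2) * √p ≤ 1 := by
    have : √p ≤ Real.exp ((p - 1) / 2) := by
      rw [Real.sqrt_le_left (Real.exp_pos _).le, ← Real.exp_nat_mul]
      have := Real.add_one_le_exp (p - 1)
      calc p = p - 1 + 1 := by ring
        _ ≤ _ := this
        _ = _ := by congr 1; push_cast; ring
    calc _ ≤ Real.exp ((1 - p) / 2) * Real.exp ((p - 1) / 2) := by gcongr
      _ = 1 := by rw [← Real.exp_add]; simp; ring
  have h2 : Real.cosh t ≤ Real.exp (t ^ 2 / (2 * p)) := by
    refine (Real.cosh_le_exp_half_sq t).trans (Real.exp_le_exp.mpr ?_)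
    exact div_le_div_of_nonneg_left (sq_nonneg t) (by positivity) (by linarith)
  calc _ = (Real.exp ((1 - p) / 2) * √p) * Real.cosh t := by ring
    _ ≤ 1 * Real.exp (t ^ 2 / (2 * p)) := by
      gcongr
    _ = _ := one_mul _

/-- Exponential moments of a Rademacher chaos are bounded by those of the Gaussian chaos. -/
theorem sum_exp_quad_mul_sqrt_det_le (ι : Type) [Fintype ι] :
    ∀ [DecidableEq ι] (P : Matrix ι ι ℝ), P.PosDef → (∀ i, P i i ≤ 1) →
      (∑ z : ι → ℤˣ, Real.exp ((Fintype.card ι - quad P (realSign z)) / 2)) * √P.det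
        ≤ 2 ^ Fintype.card ι := by
  refine Fintype.induction_empty_option
    (P := fun ι _ => ∀ [DecidableEq ι] (P : Matrix ι ι ℝ), P.PosDef → (∀ i, P i i ≤ 1) →
      (∑ z : ι → ℤˣ, Real.exp ((Fintype.card ι - quad P (realSign z)) / 2)) * √P.det
        ≤ 2 ^ Fintype.card ι) ?_ ?_ ?_ ι
  · intro α β _ e ih _ P hP hd
    classical
    let : Fintype α := Fintype.ofEquiv β e.symm
    have h := ih (P.submatrix e e) (hP.submatrix e.injective) (fun i => hd (e i))
    rw [Matrix.det_submatrix_equiv_self, Fintype.card_congr e] at h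
    refine le_trans (le_of_eq ?_) h
    congr 1
    refine (Fintype.sum_equiv (Equiv.arrowCongr e (Equiv.refl ℤˣ)) _ _ fun z => ?_).symm
    congr 3
    unfold quad
    refine Fintype.sum_equiv e _ _ fun i => Fintype.sum_equiv e _ _ fun j => ?_
    simp [realSign]
  · intro _ P _ _
    simp [quad]
  · intro κ _ ih _ P hP hd
    classical
    have hp : 0 < P none none := hP.diag_pos
    have hS := schurNone_posDef hP
    -- Passing to the Schur complement only lowers the diagonal, so the induction hypothesis applies
    -- again.
    have hdS : ∀ i, schurNone P i i ≤ 1 := fun i => by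
      have hs : P (some i) none = P none (some i) := by
        simpa using hP.isHermitian.apply none (some i)
      have : 0 ≤ P (some i) none * P none (some i) / P none none := by
        rw [hs]; exact div_nonneg (mul_self_nonneg _) hp.le
      simp only [schurNone, Matrix.of_apply]
      linarith [hd (some i)]
    have h := ih (schurNone P) hS hdS
    have hdet : P.det = P none none * (schurNone P).det := by
      convert det_eq_mul_det_schurNone hp.ne'
    rw [hdet, Real.sqrt_mul hp.le, sum_signs_option, Fintype.card_option, pow_succ, ← mul_assoc,
      mul_comm _ (2 : ℝ), Finset.sum_mul]
    refine le_trans ?_ (mul_le_mul_of_nonneg_left h zero_le_two)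
    rw [← mul_assoc, Finset.mul_sum]
    refine mul_le_mul_of_nonneg_right (Finset.sum_le_sum fun z _ => ?_) (Real.sqrt_nonneg _)
    -- With the other signs fixed, the sum over the sign at `none` is a multiple of `cosh t`, where
    -- `t` is the linear coefficient of that sign.
    set t := ∑ j, P none (some j) * realSign z j with ht
    set q := ∑ i, ∑ j, realSign z i * P (some i) (some j) * realSign z j with hq
    have e1 : quad P (realSign fun o => o.elim 1 z) = P none none + 2 * t + q := by
      rw [quad_option hP.isHermitian]
      simp [realSign, ht, hq]
    have e2 : quad P (realSign fun o => o.elim (-1) z) = P none none - 2 * t + q := by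
      rw [quad_option hP.isHermitian]
      simp [realSign, ht, hq]
      ring
    rw [e1, e2, quad_schurNone hP.isHermitian, ← ht, ← hq]
    have hc := exp_mul_cosh_le (t := t) hp (hd none)
    set p := P none none
    set n : ℝ := (Fintype.card κ : ℝ) with hn
    have s1 : Real.exp (((Fintype.card κ + 1 : ℕ) - (p + 2 * t + q)) / 2)
        = Real.exp ((n - q) / 2) * (Real.exp ((1 - p) / 2) * Real.exp (-t)) := by
      rw [← Real.exp_add, ← Real.exp_add]; congr 1; push_cast; ring
    have s2 : Real.exp (((Fintype.card κ + 1 : ℕ) - (p - 2 * t + q)) / 2)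
        = Real.exp ((n - q) / 2) * (Real.exp ((1 - p) / 2) * Real.exp t) := by
      rw [← Real.exp_add, ← Real.exp_add]; congr 1; push_cast; ring
    have s3 : Real.exp ((n - (q - t ^ 2 / p)) / 2)
        = Real.exp ((n - q) / 2) * Real.exp (t ^ 2 / (2 * p)) := by
      rw [← Real.exp_add]; congr 1; field_simp; ring
    rw [s1, s2, s3]
    calc _ = 2 * (Real.exp ((n - q) / 2) * (Real.exp ((1 - p) / 2) * Real.cosh t * √p)) := by
          rw [Real.cosh_eq]; ring
      _ ≤ _ := by gcongr

/-! ### Determinant estimate and tail bounds for the chaos. -/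

section Eigenvalues

variable {ι : Type} [Fintype ι] [DecidableEq ι] {A : Matrix ι ι ℝ}

theorem star_dotProduct_eigenvectorBasis (hA : A.IsHermitian) (i : ι) :
    star (hA.eigenvectorBasis i : ι → ℝ) ⬝ᵥ (hA.eigenvectorBasis i : ι → ℝ) = 1 := by
  have := hA.eigenvectorBasis.orthonormal.1 i
  rw [EuclideanSpace.norm_eq, Real.sqrt_eq_one] at this
  simpa [dotProduct, pow_two] using this

theorem le_eigenvalues (hA : A.IsHermitian) {c : ℝ} (h : (A - c • 1).PosSemidef) (i : ι) :
    c ≤ hA.eigenvalues i := by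
  have h1 := h.dotProduct_mulVec_nonneg (hA.eigenvectorBasis i : ι → ℝ)
  rw [Matrix.sub_mulVec, Matrix.smul_mulVec, Matrix.one_mulVec, hA.mulVec_eigenvectorBasis,
    dotProduct_sub, dotProduct_smul, dotProduct_smul, star_dotProduct_eigenvectorBasis] at h1
  simpa using h1

theorem eigenvalues_le (hA : A.IsHermitian) {c : ℝ} (h : (c • 1 - A).PosSemidef) (i : ι) :
    hA.eigenvalues i ≤ c := by
  have h1 := h.dotProduct_mulVec_nonneg (hA.eigenvectorBasis i : ι → ℝ)
  rw [Matrix.sub_mulVec, Matrix.smul_mulVec, Matrix.one_mulVec, hA.mulVec_eigenvectorBasis,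
    dotProduct_sub, dotProduct_smul, dotProduct_smul, star_dotProduct_eigenvectorBasis] at h1
  simpa using h1

end Eigenvalues

/-- With `y = u + u²`, the product `(1 - u)(1 + y + y²/2)` equals `1 + u²(1 - u - u² - u³)/2`, which
is at least `1` on this range. -/
theorem exp_neg_add_sq_le_one_sub {u : ℝ} (h0 : 0 ≤ u) (h1 : u ≤ 1 / 2) :
    Real.exp (-(u + u ^ 2)) ≤ 1 - u := by
  rw [Real.exp_neg, inv_le_comm₀ (Real.exp_pos _) (by linarith)]
  refine le_trans ?_ (Real.quadratic_le_exp_of_nonneg (by positivity))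
  rw [inv_le_iff_one_le_mul₀ (by linarith)]
  have : 0 ≤ 1 - u - u ^ 2 - u ^ 3 := by
    nlinarith [mul_nonneg h0 h0, mul_nonneg h0 (mul_nonneg h0 h0)]
  nlinarith [mul_nonneg (mul_nonneg h0 h0) this]

section Tail

variable {ι : Type} [Fintype ι] [DecidableEq ι] {M : Matrix ι ι ℝ}

/-- Upper tail of a Rademacher chaos with `0 ≤ M ≤ 1`. -/
theorem card_quad_gt_le (hM : M.PosSemidef) (hM1 : (1 - M).PosSemidef) {ε : ℝ} (h0 : 0 < ε)
    (h1 : ε ≤ 1) :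
    ((Finset.univ.filter fun z : ι → ℤˣ =>
        M.trace + ε * Fintype.card ι < quad M (realSign z)).card : ℝ)
      ≤ 2 ^ Fintype.card ι * Real.exp (-(ε ^ 2 * Fintype.card ι / 8)) := by
  set N : ℝ := (Fintype.card ι : ℝ) with hN
  -- This choice turns the moment bound into one for `exp ((ε / 4) zᵀMz)`. Since `ε ≤ 1`, the
  -- eigenvalues of `P` lie in `[1/2, 1]`, where the logarithm of the determinant is controlled to
  -- second order.
  set P : Matrix ι ι ℝ := 1 - (ε / 2) • M with hPdef
  have hPlow : (P - (1 - ε / 2) • 1).PosSemidef := by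
    have : P - (1 - ε / 2) • 1 = (ε / 2) • (1 - M) := by
      rw [hPdef, smul_sub, sub_smul, one_smul]; abel
    rw [this]; exact hM1.smul (by positivity)
  have hP : P.PosDef := by
    have : P = (1 - ε / 2) • 1 + (P - (1 - ε / 2) • 1) := by abel
    rw [this]
    exact (Matrix.PosDef.one.smul (by linarith)).add_posSemidef hPlow
  have hH := hP.isHermitian
  have hPhigh : ((1 : ℝ) • 1 - P).PosSemidef := by
    rw [hPdef, one_smul, sub_sub_cancel]; exact hM.smul (by positivity)
  have hdiag : ∀ i, P i i ≤ 1 := fun i => by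
    have : 0 ≤ M i i := hM.diag_nonneg
    simp only [hPdef, Matrix.sub_apply, Matrix.one_apply_eq, Matrix.smul_apply, smul_eq_mul]
    nlinarith
  have hle := eigenvalues_le hH hPhigh
  have hdet : Real.exp (-(ε / 2 * M.trace + ε ^ 2 / 4 * N)) ≤ P.det := by
    rw [hH.det_eq_prod_eigenvalues]
    have ht : ∑ i, (1 - hH.eigenvalues i) = ε / 2 * M.trace := by
      have h := hH.trace_eq_sum_eigenvalues
      simp [hPdef, Matrix.trace_sub, Matrix.trace_smul] at h
      rw [Finset.sum_sub_distrib, ← h]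
      simp
    calc Real.exp (-(ε / 2 * M.trace + ε ^ 2 / 4 * N))
        = ∏ i, Real.exp (-((1 - hH.eigenvalues i) + ε ^ 2 / 4)) := by
          rw [← Real.exp_sum, Finset.sum_neg_distrib, Finset.sum_add_distrib, ht]
          simp [hN, mul_comm]
      _ ≤ ∏ i, hH.eigenvalues i := by
          refine Finset.prod_le_prod (fun i _ => (Real.exp_pos _).le) fun i _ => ?_
          have hl := le_eigenvalues hH hPlow i
          have := exp_neg_add_sq_le_one_sub (u := 1 - hH.eigenvalues i) (by linarith [hle i])
            (by linarith)
          refine le_trans (Real.exp_le_exp.mpr ?_) (this.trans (by linarith))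
          nlinarith [hle i]
      _ = _ := by simp
  have hsqrt : Real.exp (-(ε / 4 * M.trace + ε ^ 2 / 8 * N)) ≤ √P.det := by
    refine Real.le_sqrt_of_sq_le (le_trans (le_of_eq ?_) hdet)
    rw [← Real.exp_nat_mul]; congr 1; push_cast; ring
  have hmom := sum_exp_quad_mul_sqrt_det_le ι P hP hdiag
  have hquad : ∀ z : ι → ℤˣ, (N - quad P (realSign z)) / 2 = ε / 4 * quad M (realSign z) := by
    intro z
    rw [hPdef, quad_sub, quad_smul, quad_one]; ring
  simp only [← hN, hquad] at hmom
  set S := Finset.univ.filter fun z : ι → ℤˣ => M.trace + ε * N < quad M (realSign z)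
  -- Markov's inequality for the exponential moment.
  have hS : (S.card : ℝ) * Real.exp (ε / 4 * (M.trace + ε * N))
      ≤ ∑ z : ι → ℤˣ, Real.exp (ε / 4 * quad M (realSign z)) := by
    rw [← nsmul_eq_mul]
    refine (Finset.card_nsmul_le_sum S _ _ fun z hz => ?_).trans
      (Finset.sum_le_sum_of_subset_of_nonneg (Finset.subset_univ _)
        fun _ _ _ => (Real.exp_pos _).le)
    have := (Finset.mem_filter.mp hz).2
    exact Real.exp_le_exp.mpr (by gcongr)
  have hfin : (S.card : ℝ) * Real.exp (ε / 4 * (M.trace + ε * N))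
      * Real.exp (-(ε / 4 * M.trace + ε ^ 2 / 8 * N)) ≤ 2 ^ Fintype.card ι :=
    le_trans (mul_le_mul hS hsqrt (Real.exp_pos _).le
      (Finset.sum_nonneg fun _ _ => (Real.exp_pos _).le)) hmom
  rw [mul_assoc, ← Real.exp_add] at hfin
  have : ε / 4 * (M.trace + ε * N) + -(ε / 4 * M.trace + ε ^ 2 / 8 * N) = ε ^ 2 * N / 8 := by ring
  rw [this] at hfin
  rw [Real.exp_neg, ← div_eq_mul_inv, le_div_iff₀ (Real.exp_pos _)]
  exact hfin

theorem card_abs_quad_sub_trace_gt_le (hM : M.PosSemidef) (hM1 : (1 - M).PosSemidef) {ε : ℝ}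
    (h0 : 0 < ε) (h1 : ε ≤ 1) :
    ((Finset.univ.filter fun z : ι → ℤˣ =>
        ε * Fintype.card ι < |quad M (realSign z) - M.trace|).card : ℝ)
      ≤ 2 * (2 ^ Fintype.card ι * Real.exp (-(ε ^ 2 * Fintype.card ι / 8))) := by
  have hu := card_quad_gt_le hM hM1 h0 h1
  -- The form of `1 - M` at a sign vector is `N - zᵀMz`, so the lower tail of `M` is the upper tail
  -- of `1 - M`.
  have hl := card_quad_gt_le hM1 (by simpa using hM) h0 h1
  rw [two_mul]
  refine le_trans ?_ (add_le_add hu hl)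
  rw [← Nat.cast_add, Nat.cast_le]
  refine (Finset.card_le_card fun z hz => ?_).trans (Finset.card_union_le _ _)
  simp only [Finset.mem_union, Finset.mem_filter, Finset.mem_univ, true_and] at hz ⊢
  rw [quad_sub, quad_one, Matrix.trace_sub, Matrix.trace_one]
  rcases lt_abs.mp hz with h | h
  · left; linarith
  · right; linarith

/-- Nonnegativity of the form at `zᵢeᵢ - zⱼeⱼ` bounds each term by the average of two diagonal
entries. -/
theorem quad_le_card_mul_trace (hM : M.PosSemidef) (z : ι → ℤˣ) :
    quad M (realSign z) ≤ Fintype.card ι * M.trace := by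
  have key : ∀ i j, realSign z i * M i j * realSign z j ≤ (M i i + M j j) / 2 := by
    intro i j
    have hs : M j i = M i j := by simpa using hM.isHermitian.apply i j
    have h := quad_nonneg hM (Pi.single i (realSign z i) - Pi.single j (realSign z j))
    have : quad M (Pi.single i (realSign z i) - Pi.single j (realSign z j))
        = M i i + M j j - 2 * (realSign z i * M i j * realSign z j) := by
      simp only [quad, Pi.sub_apply, sub_mul, mul_sub, Finset.sum_sub_distrib, Pi.single_apply,
        ite_mul, mul_ite, zero_mul, mul_zero, Finset.sum_ite_eq', Finset.mem_univ, if_true]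
      simp [hs]
      linear_combination M i i * realSign_mul_self z i + M j j * realSign_mul_self z j
    linarith
  calc quad M (realSign z) ≤ ∑ i, ∑ j, (M i i + M j j) / 2 :=
        Finset.sum_le_sum fun i _ => Finset.sum_le_sum fun j _ => key i j
    _ = Fintype.card ι * M.trace := by
        simp only [← Finset.sum_div, Finset.sum_add_distrib, Finset.sum_const, Finset.card_univ,
          nsmul_eq_mul, Matrix.trace, Matrix.diag, ← Finset.mul_sum]
        ring

/-- No sign vector can distinguish with advantage exceeding `1 - 1 / N`. -/
theorem abs_quad_sub_trace_le [Nonempty ι] (hM : M.PosSemidef) (hM1 : (1 - M).PosSemidef)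
    (z : ι → ℤˣ) : |quad M (realSign z) - M.trace| ≤ Fintype.card ι - 1 := by
  have aux : ∀ {A : Matrix ι ι ℝ}, A.PosSemidef → (1 - A).PosSemidef →
      quad A (realSign z) - A.trace ≤ Fintype.card ι - 1 := by
    intro A hA hA1
    have h1 := quad_le_card_mul_trace hA z
    have h2 := quad_nonneg hA1 (realSign z)
    rw [quad_sub, quad_one] at h2
    have hN : (1 : ℝ) ≤ Fintype.card ι := by exact_mod_cast Fintype.card_pos
    have h3 := hA.trace_nonneg
    -- The form is at most both `N tr A` and `N`: the first bound suffices when `tr A ≤ 1`, the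
    -- second when `tr A ≥ 1`.
    nlinarith
  have hu := aux hM hM1
  have hl := aux hM1 (by simpa using hM)
  rw [quad_sub, quad_one, Matrix.trace_sub, Matrix.trace_one] at hl
  rw [abs_le]
  constructor <;> linarith

end Tail

/-! ### Operators extended by the identity to a larger register. -/

/-- The operator on the qubits `W` acting as `A` on the image of `e` and as the identity on the
remaining qubits. -/
noncomputable def embed {V W : Type} (e : V ↪ W) (A : Op V) : Op W :=
  open Classical in
  Matrix.of fun x y =>
    if ∀ w, w ∉ Set.range e → x w = y w then A (fun j => x (e j)) (fun j => y (e j)) else 0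

theorem PlacedGate.toOp_eq_embed {G : GateSet} {W : Type} (p : PlacedGate G W) :
    p.toOp = embed p.wires p.gate.2.1 := rfl

section Embed

variable {V W : Type} [Fintype V] [Fintype W] [DecidableEq W]

/-- Splitting a basis label into its restrictions to the image of `e` and to the complement. -/
noncomputable def splitBits (e : V ↪ W) : Bits W ≃ Bits V × Bits ↥(Set.range e)ᶜ :=
  open Classical in
  (Equiv.arrowCongr ((Equiv.sumCongr (Equiv.ofInjective e e.injective) (Equiv.refl _)).trans
    (Equiv.Set.sumCompl (Set.range e))).symm (Equiv.refl (Fin 2))).trans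
    (Equiv.sumArrowEquivProdArrow _ _ _)

theorem splitBits_fst {V W : Type} [Fintype V] [DecidableEq W] (e : V ↪ W) (x : Bits W) :
    (splitBits e x).1 = fun j => x (e j) := by
  ext j
  simp [splitBits, Equiv.sumArrowEquivProdArrow]

theorem splitBits_snd {V W : Type} [Fintype V] [DecidableEq W] (e : V ↪ W) (x : Bits W) :
    (splitBits e x).2 = fun w : ↥(Set.range e)ᶜ => x w := by
  ext j
  simp [splitBits, Equiv.sumArrowEquivProdArrow]

/-- Up to relabelling the basis, an embedded operator is `A ⊗ 1`, so its algebra reduces to that of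
Kronecker products. -/
theorem embed_eq_submatrix (e : V ↪ W) (A : Op V) :
    embed e A = (A ⊗ₖ (1 : Op ↥(Set.range e)ᶜ)).submatrix (splitBits e) (splitBits e) := by
  classical
  ext x y
  have : (∀ w, w ∉ Set.range e → x w = y w) ↔ (splitBits e x).2 = (splitBits e y).2 := by
    rw [splitBits_snd, splitBits_snd]
    simp [funext_iff]
  simp only [embed, Matrix.of_apply, Matrix.submatrix_apply, Matrix.kroneckerMap_apply, this,
    Matrix.one_apply, splitBits_fst, mul_ite, mul_one, mul_zero]

theorem embed_conjTranspose (e : V ↪ W) (A : Op V) :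
    (embed e A).conjTranspose = embed e A.conjTranspose := by
  classical
  rw [embed_eq_submatrix, embed_eq_submatrix, Matrix.conjTranspose_submatrix,
    Matrix.conjTranspose_kronecker, Matrix.conjTranspose_one]

theorem embed_one (e : V ↪ W) : embed e (1 : Op V) = 1 := by
  classical
  rw [embed_eq_submatrix, Matrix.one_kronecker_one, Matrix.submatrix_one_equiv]

theorem embed_mul [DecidableEq V] (e : V ↪ W) (A B : Op V) :
    embed e (A * B) = embed e A * embed e B := by
  classical
  rw [embed_eq_submatrix, embed_eq_submatrix, embed_eq_submatrix, Matrix.submatrix_mul_equiv,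
    ← Matrix.mul_kronecker_mul, one_mul]

theorem embed_diagonal (e : V ↪ W) (f : Bits V → ℂ) :
    embed e (Matrix.diagonal f) = Matrix.diagonal fun x => f fun j => x (e j) := by
  classical
  rw [embed_eq_submatrix]
  ext x y
  simp only [Matrix.submatrix_apply, Matrix.kroneckerMap_apply, Matrix.diagonal_apply,
    Matrix.one_apply, mul_ite, mul_one, mul_zero, ← splitBits_fst]
  by_cases h : x = y
  · simp [h]
  · have : ¬ ((splitBits e x).2 = (splitBits e y).2 ∧ (splitBits e x).1 = (splitBits e y).1) :=
      fun h' => h ((splitBits e).injective (Prod.ext h'.2 h'.1))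
    rw [if_neg h]
    split_ifs <;> tauto

end Embed

theorem embed_embed {U V W : Type} (e : V ↪ W) (d : U ↪ V) (A : Op U) :
    embed e (embed d A) = embed (d.trans e) A := by
  classical
  ext x y
  simp only [embed, Matrix.of_apply, Function.Embedding.trans_apply]
  by_cases h : ∀ w, w ∉ Set.range (d.trans e) → x w = y w
  · have h1 : ∀ w, w ∉ Set.range e → x w = y w := fun w hw =>
      h w fun ⟨u, hu⟩ => hw ⟨d u, hu⟩
    have h2 : ∀ v, v ∉ Set.range d → x (e v) = y (e v) := fun v hv =>
      h _ fun ⟨u, hu⟩ => hv ⟨u, e.injective hu⟩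
    rw [if_pos h, if_pos h1, if_pos h2]
  · rw [if_neg h]
    split_ifs with h1 h2
    · refine absurd (fun w hw => ?_) h
      by_cases hw' : w ∈ Set.range e
      · obtain ⟨v, rfl⟩ := hw'
        exact h2 v fun ⟨u, hu⟩ => hw ⟨u, congrArg e hu⟩
      · exact h1 w hw'
    · rfl
    · rfl

namespace PlacedGate

variable {G : GateSet} {V W : Type}

/-- The same gate on renamed wires. -/
def map (e : V ↪ W) (p : PlacedGate G V) : PlacedGate G W := ⟨p.gate, p.mem, p.wires.trans e⟩

theorem toOp_map (e : V ↪ W) (p : PlacedGate G V) : (p.map e).toOp = embed e p.toOp := by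
  rw [toOp_eq_embed, toOp_eq_embed, embed_embed]
  rfl

theorem conjTranspose_toOp_mul_toOp [Fintype W] [DecidableEq W] (p : PlacedGate G W) :
    p.toOp.conjTranspose * p.toOp = 1 := by
  rw [toOp_eq_embed, embed_conjTranspose, ← embed_mul, ← embed_one p.wires]
  congr 1
  exact Matrix.mem_unitaryGroup_iff'.mp p.gate.2.2

theorem exists_map_eq (e : V ↪ W) (p : PlacedGate G W) (h : ∀ j, p.wires j ∈ Set.range e) :
    ∃ q : PlacedGate G V, q.map e = p := by
  choose f hf using h
  refine ⟨⟨p.gate, p.mem, f, fun i j hij => p.wires.injective ?_⟩, ?_⟩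
  · rw [← hf i, ← hf j, hij]
  · obtain ⟨g, hg, w⟩ := p
    simp only [map, PlacedGate.mk.injEq, heq_eq_eq, true_and]
    ext j
    exact hf j

end PlacedGate

/-! ### Effects of distinguishers and their invariance under renaming ancillas. -/

namespace Distinguisher

variable {G : GateSet} {m : ℕ}

/-- The Heisenberg-picture measurement operator on all qubits. -/
noncomputable def fullEffect (D : Distinguisher G m) : Op (Fin m ⊕ Fin D.ancillas) :=
  D.unitary.conjTranspose * D.proj * D.unitary

/-- The measurement operator on the input qubits. -/
noncomputable def effect (D : Distinguisher G m) : Op (Fin m) :=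
  D.fullEffect.submatrix (fun x => Sum.elim x 0) (fun x => Sum.elim x 0)

theorem acceptProb_eq (D : Distinguisher G m) (ρ : Op (Fin m)) :
    D.acceptProb ρ = (Matrix.trace (D.effect * ρ)).re := by
  have h1 : Matrix.trace (D.proj * (D.unitary * D.initial ρ * D.unitary.conjTranspose))
      = Matrix.trace (D.fullEffect * D.initial ρ) := by
    rw [← Matrix.mul_assoc, Matrix.trace_mul_comm, fullEffect]
    simp only [Matrix.mul_assoc]
  rw [acceptProb, h1]
  congr 1
  simp only [Matrix.trace, Matrix.diag, Matrix.mul_apply]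
  let e := (Equiv.sumArrowEquivProdArrow (Fin m) (Fin D.ancillas) (Fin 2)).symm
  rw [← Equiv.sum_comp e, Fintype.sum_prod_type]
  refine Finset.sum_congr rfl fun x _ => ?_
  have h2 : ∀ a, ∑ v, D.fullEffect (e (x, a)) v * D.initial ρ v (e (x, a))
      = ∑ y, ∑ b, D.fullEffect (e (x, a)) (e (y, b)) * D.initial ρ (e (y, b)) (e (x, a)) := by
    intro a
    rw [← Equiv.sum_comp e, Fintype.sum_prod_type]
  have h3 : ∀ y b a, D.initial ρ (e (y, b)) (e (x, a))
      = ρ y x * (if 0 = b ∧ 0 = a then 1 else 0) := by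
    intro y b a
    simp [initial, e, Matrix.single_apply, Equiv.sumArrowEquivProdArrow]
  simp only [h2, h3]
  -- Only the all-zero ancilla label contributes, on each side of the matrix product.
  rw [Finset.sum_eq_single 0 (fun a _ ha => by simp [ha.symm]) (by simp)]
  refine Finset.sum_congr rfl fun y _ => ?_
  rw [Finset.sum_eq_single 0 (fun a _ ha => by simp [ha.symm]) (by simp)]
  simp only [and_self, if_true, mul_one]
  rfl

theorem conjTranspose_unitary_mul_unitary (D : Distinguisher G m) :
    D.unitary.conjTranspose * D.unitary = 1 := by
  unfold unitary
  induction D.gates with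
  | nil => simp
  | cons p l ih =>
    rw [List.map_cons, List.prod_cons, Matrix.conjTranspose_mul, Matrix.mul_assoc,
      ← Matrix.mul_assoc _ p.toOp, p.conjTranspose_toOp_mul_toOp, Matrix.one_mul, ih]

theorem effect_posSemidef (D : Distinguisher G m) : D.effect.PosSemidef := by
  refine Matrix.PosSemidef.submatrix (Matrix.PosSemidef.conjTranspose_mul_mul_same ?_ _) _
  refine Matrix.PosSemidef.diagonal fun x => ?_
  simp only [Pi.zero_apply]
  split_ifs <;> simp

theorem one_sub_effect_posSemidef (D : Distinguisher G m) : (1 - D.effect).PosSemidef := by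
  have hinj : Function.Injective
      (fun x : Bits (Fin m) => (Sum.elim x 0 : Bits (Fin m ⊕ Fin D.ancillas))) :=
    fun x y h => funext fun i => congrFun h (Sum.inl i)
  have h1 : 1 - D.effect = (D.unitary.conjTranspose * (1 - D.proj) * D.unitary).submatrix
      (fun x => Sum.elim x 0) (fun x => Sum.elim x 0) := by
    rw [Matrix.mul_sub, Matrix.sub_mul, Matrix.mul_one, conjTranspose_unitary_mul_unitary,
      Matrix.submatrix_sub, Pi.sub_apply, Pi.sub_apply, Matrix.submatrix_one _ hinj]
    rfl
  rw [h1]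
  refine Matrix.PosSemidef.submatrix (Matrix.PosSemidef.conjTranspose_mul_mul_same ?_ _) _
  have : 1 - D.proj = Matrix.diagonal fun x => if x D.out = 1 then 0 else 1 := by
    rw [proj, ← Matrix.diagonal_one, Matrix.diagonal_sub]
    congr 1
    ext x
    split_ifs <;> simp
  rw [this]
  refine Matrix.PosSemidef.diagonal fun x => ?_
  simp only [Pi.zero_apply]
  split_ifs <;> simp

/-- Renaming the ancillas. -/
def mapAncillas {b : ℕ} (D : Distinguisher G m) (e : Fin D.ancillas ↪ Fin b) :
    Distinguisher G m where
  ancillas := b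
  gates := D.gates.map (PlacedGate.map ((Function.Embedding.refl _).sumMap e))
  out := (Function.Embedding.refl _).sumMap e D.out

theorem effect_mapAncillas {b : ℕ} (D : Distinguisher G m) (e : Fin D.ancillas ↪ Fin b) :
    (D.mapAncillas e).effect = D.effect := by
  set i : Fin m ⊕ Fin D.ancillas ↪ Fin m ⊕ Fin b := (Function.Embedding.refl _).sumMap e with hi
  have hU : (D.mapAncillas e).unitary = embed i D.unitary := by
    unfold unitary
    change ((D.gates.map (PlacedGate.map i)).map PlacedGate.toOp).prod = _
    induction D.gates with
    | nil => exact (embed_one i).symm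
    | cons p l ih =>
      rw [List.map_cons, List.map_cons, List.prod_cons, ih, List.map_cons, List.prod_cons,
        embed_mul, PlacedGate.toOp_map]
  have hP : (D.mapAncillas e).proj = embed i D.proj := by
    rw [proj, proj, embed_diagonal]
    rfl
  have hE : (D.mapAncillas e).fullEffect = embed i D.fullEffect := by
    rw [fullEffect, hU, hP]
    change (embed i D.unitary).conjTranspose * embed i D.proj * embed i D.unitary = _
    rw [fullEffect, embed_mul, embed_mul, embed_conjTranspose]
  ext x y
  have hj : ∀ x : Bits (Fin m), (fun j => (Sum.elim x 0 : Bits (Fin m ⊕ Fin b)) (i j))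
      = Sum.elim x 0 := by
    intro x
    ext j
    cases j <;> simp [hi]
  unfold effect
  rw [hE]
  simp only [Matrix.submatrix_apply]
  -- Wires outside the range of `i` are ancillas no gate touches; both labels are `0` there, so the
  -- identity factor contributes `1`.
  have : ∀ w, w ∉ Set.range i →
      (Sum.elim x 0 : Bits (Fin m ⊕ Fin b)) w = (Sum.elim y 0 : Bits (Fin m ⊕ Fin b)) w := by
    rintro (w | w) hw
    · exact absurd ⟨Sum.inl w, rfl⟩ hw
    · rfl
  change embed i D.fullEffect (Sum.elim x 0 : Bits (Fin m ⊕ Fin b)) (Sum.elim y 0) = _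
  rw [embed, Matrix.of_apply, if_pos this, hj, hj]

end Distinguisher

/-! ### Counting the effects of small circuits. -/

/-- The largest number of qubits of a gate of `G`. -/
def maxArity (G : GateSet) : ℕ := G.sup fun g => g.1

namespace Distinguisher

variable {G : GateSet} {m : ℕ}

/-- A circuit uses few wires. -/
theorem exists_finset_wires {W : Type} [DecidableEq W] (l : List (PlacedGate G W)) :
    ∃ T : Finset W, T.card ≤ maxArity G * l.length ∧ ∀ p ∈ l, ∀ j, p.wires j ∈ T := by
  induction l with
  | nil => exact ⟨∅, by simp⟩
  | cons p l ih =>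
    obtain ⟨T, hT, h⟩ := ih
    refine ⟨Finset.univ.map p.wires ∪ T, ?_, ?_⟩
    · have : p.gate.1 ≤ maxArity G := Finset.le_sup (f := fun g : ElementaryGate => g.1) p.mem
      have := Finset.card_union_le (Finset.univ.map p.wires) T
      rw [Finset.card_map, Finset.card_univ, Fintype.card_fin] at this
      rw [List.length_cons, mul_add, mul_one]
      omega
    · intro q hq j
      rcases List.mem_cons.mp hq with rfl | hq
      · exact Finset.mem_union_left _ (Finset.mem_map_of_mem _ (Finset.mem_univ j))
      · exact Finset.mem_union_right _ (h q hq j)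

/-- A small circuit needs only few ancillas. -/
theorem exists_effect_eq {s : ℕ} (D : Distinguisher G m) (hD : D.size ≤ s) :
    ∃ (l : List (PlacedGate G (Fin m ⊕ Fin (maxArity G * s + 1))))
      (o : Fin m ⊕ Fin (maxArity G * s + 1)), l.length ≤ s ∧
      (Distinguisher.mk (maxArity G * s + 1) l o).effect = D.effect := by
  obtain ⟨a, gates, out⟩ := D
  change gates.length ≤ s at hD
  obtain ⟨T, hT, h⟩ := exists_finset_wires gates
  -- The ancillas that matter: those touched by a gate, and possibly the output qubit, which
  -- accounts for the `+ 1`.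
  set S := (insert out T).toRight with hS
  have hcard : S.card ≤ maxArity G * s + 1 := by
    have h1 : S.card ≤ _ := Finset.card_toRight_le
    have h2 := Finset.card_insert_le out T
    have h3 := Nat.mul_le_mul_left (maxArity G) hD
    omega
  let e : Fin S.card ↪ Fin a := (S.orderEmbOfFin rfl).toEmbedding
  let i : Fin m ⊕ Fin S.card ↪ Fin m ⊕ Fin a := (Function.Embedding.refl _).sumMap e
  have hi : ∀ w ∈ insert out T, w ∈ Set.range i := by
    rintro (w | w) hw
    · exact ⟨Sum.inl w, rfl⟩
    · have hw' : w ∈ Set.range (S.orderEmbOfFin rfl) := by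
        rw [Finset.range_orderEmbOfFin]
        exact Finset.mem_toRight.mpr hw
      obtain ⟨v, hv⟩ := hw'
      exact ⟨Sum.inr v, congrArg Sum.inr hv⟩
  obtain ⟨o, ho⟩ := hi out (Finset.mem_insert_self _ _)
  have hl : gates ∈ Set.range (List.map (PlacedGate.map (G := G) i)) := by
    rw [Set.range_list_map]
    exact fun p hp => p.exists_map_eq i fun j => hi _ (Finset.mem_insert_of_mem (h p hp j))
  obtain ⟨l, hl⟩ := hl
  -- Both the given circuit and the one with the uniform number of ancillas are renamings of `D0`,
  -- hence have the same effect.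
  let D0 : Distinguisher G m := ⟨S.card, l, o⟩
  have hD0 : D0.mapAncillas e = ⟨a, gates, out⟩ := by
    change Distinguisher.mk a (l.map (PlacedGate.map i)) (i o) = _
    rw [hl, ho]
  have h0 := D0.effect_mapAncillas e
  rw [hD0] at h0
  refine ⟨_, _, ?_, (D0.effect_mapAncillas (Fin.castLEEmb hcard)).trans h0.symm⟩
  rw [List.length_map]
  rw [← hl, List.length_map] at hD
  exact hD

end Distinguisher

section Counting

variable (G : GateSet)

/-- The gate and the padded list of wires determine a placed gate. -/
noncomputable def PlacedGate.code {W : Type} (w₀ : W) (p : PlacedGate G W) :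
    G × (Fin (maxArity G) → W) :=
  (⟨p.gate, p.mem⟩, fun j => if h : (j : ℕ) < p.gate.1 then p.wires ⟨j, h⟩ else w₀)

theorem PlacedGate.code_injective {W : Type} (w₀ : W) :
    Function.Injective (PlacedGate.code G w₀) := by
  rintro ⟨g, hg, w⟩ ⟨g', hg', w'⟩ h
  simp only [code, Prod.mk.injEq, Subtype.mk.injEq] at h
  obtain ⟨rfl, h⟩ := h
  have hle : g.1 ≤ maxArity G := Finset.le_sup (f := fun g : ElementaryGate => g.1) hg
  simp only [PlacedGate.mk.injEq, heq_eq_eq, true_and]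
  ext j
  simpa using congrFun h ⟨j, j.2.trans_le hle⟩

/-- There are few effects of small distinguishers. -/
theorem exists_finset_effects (m s : ℕ) : ∃ F : Finset (Op (Fin m)),
    F.card ≤ (G.card * (m + (maxArity G * s + 1)) ^ maxArity G + 1) ^ s
        * (m + (maxArity G * s + 1)) ∧
      (∀ A ∈ F, ∃ D : Distinguisher G m, D.effect = A) ∧
      ∀ D : Distinguisher G m, D.size ≤ s → D.effect ∈ F := by
  classical
  let W := Fin m ⊕ Fin (maxArity G * s + 1)
  let w₀ : W := Sum.inr 0
  let _ : Fintype (PlacedGate G W) := Fintype.ofInjective _ (PlacedGate.code_injective G w₀)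
  have hP : Fintype.card (PlacedGate G W)
      ≤ G.card * (m + (maxArity G * s + 1)) ^ maxArity G := by
    refine (Fintype.card_le_of_injective _ (PlacedGate.code_injective G w₀)).trans (le_of_eq ?_)
    simp [W]
  let E : List.Vector (Option (PlacedGate G W)) s × W → Op (Fin m) := fun p =>
    (Distinguisher.mk (maxArity G * s + 1) p.1.1.reduceOption p.2).effect
  refine ⟨Finset.univ.image E, ?_, ?_, ?_⟩
  · refine Finset.card_image_le.trans ?_
    rw [Finset.card_univ, Fintype.card_prod, card_vector, Fintype.card_option]
    have : Fintype.card W = m + (maxArity G * s + 1) := by simp [W]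
    rw [this]
    gcongr
  · intro A hA
    obtain ⟨p, -, rfl⟩ := Finset.mem_image.mp hA
    exact ⟨_, rfl⟩
  · intro D hD
    obtain ⟨l, o, hl, h⟩ := D.exists_effect_eq hD
    -- Circuits shorter than `s` are padded with `none` to length exactly `s`; `reduceOption`
    -- removes the padding.
    refine Finset.mem_image.mpr
      ⟨(⟨l.map some ++ List.replicate (s - l.length) none, by simp [hl]⟩, o),
        Finset.mem_univ _, ?_⟩
    rw [← h]
    simp only [E]
    congr 2
    rw [List.reduceOption_append, List.reduceOption_replicate_none, List.append_nil]
    simp [List.reduceOption]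

end Counting

/-! ### Acceptance probabilities as real quadratic forms. -/

section RealPart

variable {ι : Type} [Fintype ι]

theorem quad_map_re (A : Matrix ι ι ℂ) (v : ι → ℝ) :
    quad (A.map Complex.re) v
      = (star (fun i => (v i : ℂ)) ⬝ᵥ A.mulVec fun i => (v i : ℂ)).re := by
  simp only [quad, dotProduct, Matrix.mulVec, Complex.re_sum, Finset.mul_sum]
  refine Finset.sum_congr rfl fun i _ => Finset.sum_congr rfl fun j _ => ?_
  simp [mul_assoc]

theorem posSemidef_map_re {A : Matrix ι ι ℂ} (hA : A.PosSemidef) :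
    (A.map Complex.re).PosSemidef := by
  refine Matrix.PosSemidef.of_dotProduct_mulVec_nonneg ?_ fun v => ?_
  · ext i j
    have := congrArg Complex.re (hA.isHermitian.apply i j)
    simpa using this
  · rw [dotProduct_mulVec_eq_quad, quad_map_re]
    exact (Complex.le_def.mp (hA.dotProduct_mulVec_nonneg _)).1

end RealPart

theorem card_bits (m : ℕ) : (Fintype.card (Bits (Fin m)) : ℝ) = 2 ^ m := by simp

theorem signVector_apply {m : ℕ} (z : Signs m) (x : Bits (Fin m)) :
    signVector z x = ((realSign z x * (2 : ℝ) ^ (-(m : ℝ) / 2) : ℝ) : ℂ) := rfl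

theorem rpow_neg_half_mul_self (m : ℕ) :
    (2 : ℝ) ^ (-(m : ℝ) / 2) * (2 : ℝ) ^ (-(m : ℝ) / 2) = (2 ^ m)⁻¹ := by
  rw [← Real.rpow_add two_pos, add_halves, Real.rpow_neg zero_le_two, Real.rpow_natCast]

theorem isPureState_ketbra_signVector {m : ℕ} (z : Signs m) :
    IsPureState (ketbra (signVector z)) := by
  refine ⟨_, ?_, rfl⟩
  have h : ∀ x, star (signVector z x) * signVector z x = (((2 ^ m)⁻¹ : ℝ) : ℂ) := by
    intro x
    rw [signVector_apply, Complex.star_def, Complex.conj_ofReal, ← Complex.ofReal_mul,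
      mul_mul_mul_comm, realSign_mul_self, rpow_neg_half_mul_self, one_mul]
  simp only [dotProduct, Pi.star_apply, h, Finset.sum_const, Finset.card_univ, nsmul_eq_mul]
  have := card_bits m
  rw [← Complex.ofReal_natCast, this, ← Complex.ofReal_mul, mul_inv_cancel₀ (by positivity),
    Complex.ofReal_one]

namespace Distinguisher

variable {G : GateSet} {m : ℕ}

/-- The real part of the effect, which determines the acceptance probability on real vectors. -/
noncomputable def reEffect (D : Distinguisher G m) : Matrix (Bits (Fin m)) (Bits (Fin m)) ℝ :=
  D.effect.map Complex.re

theorem reEffect_posSemidef (D : Distinguisher G m) : D.reEffect.PosSemidef :=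
  posSemidef_map_re D.effect_posSemidef

theorem one_sub_reEffect_posSemidef (D : Distinguisher G m) : (1 - D.reEffect).PosSemidef := by
  have : 1 - D.reEffect = (1 - D.effect).map Complex.re := by
    ext x y
    by_cases h : x = y <;> simp [reEffect, h]
  rw [this]
  exact posSemidef_map_re D.one_sub_effect_posSemidef

theorem acceptProb_ketbra_signVector (D : Distinguisher G m) (z : Signs m) :
    D.acceptProb (ketbra (signVector z)) = (2 ^ m)⁻¹ * quad D.reEffect (realSign z) := by
  rw [acceptProb_eq]
  simp only [Matrix.trace, Matrix.diag, Matrix.mul_apply, Complex.re_sum, quad, Finset.mul_sum]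
  refine Finset.sum_congr rfl fun x _ => Finset.sum_congr rfl fun y _ => ?_
  rw [ketbra, Matrix.vecMulVec_apply, Pi.star_apply, signVector_apply, signVector_apply,
    Complex.star_def, Complex.conj_ofReal, ← Complex.ofReal_mul, Complex.re_mul_ofReal,
    ← rpow_neg_half_mul_self, reEffect, Matrix.map_apply]
  ring

theorem acceptProb_maximallyMixed (D : Distinguisher G m) :
    D.acceptProb (maximallyMixed m) = (2 ^ m)⁻¹ * D.reEffect.trace := by
  rw [acceptProb_eq, maximallyMixed, Matrix.mul_smul, Matrix.mul_one, Matrix.trace_smul]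
  have h : ((2 : ℂ) ^ m)⁻¹ = (((2 ^ m)⁻¹ : ℝ) : ℂ) := by push_cast; rfl
  rw [h, smul_eq_mul, Complex.re_ofReal_mul]
  simp [Matrix.trace, reEffect]

theorem abs_acceptProb_sub (D : Distinguisher G m) (z : Signs m) :
    |D.acceptProb (ketbra (signVector z)) - D.acceptProb (maximallyMixed m)|
      = (2 ^ m)⁻¹ * |quad D.reEffect (realSign z) - D.reEffect.trace| := by
  rw [acceptProb_ketbra_signVector, acceptProb_maximallyMixed, ← mul_sub, abs_mul,
    abs_of_pos (by positivity : (0 : ℝ) < (2 ^ m)⁻¹)]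

theorem abs_acceptProb_sub_le (D : Distinguisher G m) (z : Signs m) :
    |D.acceptProb (ketbra (signVector z)) - D.acceptProb (maximallyMixed m)|
      ≤ 1 - (2 ^ m)⁻¹ := by
  rw [abs_acceptProb_sub, inv_mul_le_iff₀ (by positivity), mul_sub, mul_inv_cancel₀ (by positivity),
    mul_one, ← card_bits]
  exact abs_quad_sub_trace_le D.reEffect_posSemidef D.one_sub_reEffect_posSemidef z

/-- Without gates, sign vectors are perfectly indistinguishable from the maximally mixed state. -/
theorem quad_reEffect_of_size_eq_zero (D : Distinguisher G m) (hD : D.size = 0) (z : Signs m) :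
    quad D.reEffect (realSign z) = D.reEffect.trace := by
  have hg : D.gates = [] := List.eq_nil_of_length_eq_zero hD
  have hE : D.fullEffect = D.proj := by simp [fullEffect, unitary, hg]
  -- Without gates the effect is diagonal, and a diagonal form cannot see the signs.
  have hoff : ∀ x y, x ≠ y → D.reEffect x y = 0 := by
    intro x y hxy
    have : (Sum.elim x 0 : Bits (Fin m ⊕ Fin D.ancillas)) ≠ Sum.elim y 0 := fun h =>
      hxy (funext fun i => congrFun h (Sum.inl i))
    rw [reEffect, effect, hE, Matrix.map_apply, Matrix.submatrix_apply, proj,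
      Matrix.diagonal_apply_ne _ this, Complex.zero_re]
  refine Finset.sum_congr rfl fun x _ => ?_
  rw [Finset.sum_eq_single x (fun y _ hy => by rw [hoff x y hy.symm]; ring) (by simp),
    mul_right_comm, realSign_mul_self, one_mul]
  rfl

end Distinguisher

/-! ### Union bound and choice of parameters. -/

theorem signProb_eq_one {m : ℕ} {E : Signs m → Prop} (h : ∀ z, E z) : signProb E = 1 := by
  classical
  unfold signProb
  rw [Finset.filter_true_of_mem fun z _ => h z, Finset.card_univ, div_self]
  exact_mod_cast Fintype.card_ne_zero

theorem one_sub_le_signProb {m : ℕ} {E : Signs m → Prop} {δ : ℝ} (S : Finset (Signs m))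
    (hS : ∀ z, ¬ E z → z ∈ S) (h : (S.card : ℝ) ≤ δ * Fintype.card (Signs m)) :
    1 - δ ≤ signProb E := by
  classical
  unfold signProb
  have hpos : (0 : ℝ) < Fintype.card (Signs m) := by exact_mod_cast Fintype.card_pos
  rw [le_div_iff₀ hpos, sub_mul, one_mul]
  have h1 : (Finset.univ : Finset (Signs m)) ⊆ Finset.univ.filter E ∪ S := fun z _ => by
    by_cases hz : E z
    · exact Finset.mem_union_left _ (Finset.mem_filter.mpr ⟨Finset.mem_univ _, hz⟩)
    · exact Finset.mem_union_right _ (hS z hz)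
  have h2 : Fintype.card (Signs m) ≤ (Finset.univ.filter E).card + S.card :=
    (Finset.card_le_card h1).trans (Finset.card_union_le _ _)
  have h3 : (Fintype.card (Signs m) : ℝ) ≤ (Finset.univ.filter E).card + S.card := by
    exact_mod_cast h2
  convert (by linarith : (Fintype.card (Signs m) : ℝ) - δ * Fintype.card (Signs m)
    ≤ (Finset.univ.filter E).card)

/-- The union bound over all small distinguishers. -/
theorem exists_finset_distinguished (G : GateSet) (m s : ℕ) {ε : ℝ} (h0 : 0 < ε) (h1 : ε ≤ 1) :
    ∃ S : Finset (Signs m),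
      (∀ z, ¬ Pseudorandom G s ε (ketbra (signVector z)) → z ∈ S) ∧
      (S.card : ℝ) ≤ ((G.card * (m + (maxArity G * s + 1)) ^ maxArity G + 1) ^ s
        * (m + (maxArity G * s + 1)) : ℕ)
        * (2 * Real.exp (-(ε ^ 2 * 2 ^ m / 8))) * Fintype.card (Signs m) := by
  classical
  obtain ⟨F, hF, hFD, hDF⟩ := exists_finset_effects G m s
  let B : Op (Fin m) → Finset (Signs m) := fun A => Finset.univ.filter fun z =>
    ε * Fintype.card (Bits (Fin m)) < |quad (A.map Complex.re) (realSign z)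
      - (A.map Complex.re).trace|
  refine ⟨F.biUnion B, fun z hz => ?_, ?_⟩
  · simp only [Pseudorandom, Indistinguishable, not_forall, not_le] at hz
    obtain ⟨D, hD, h⟩ := hz
    refine Finset.mem_biUnion.mpr ⟨_, hDF D hD, Finset.mem_filter.mpr ⟨Finset.mem_univ _, ?_⟩⟩
    rw [D.abs_acceptProb_sub, lt_inv_mul_iff₀ (by positivity)] at h
    rw [card_bits, mul_comm]
    exact h
  · have hcard : (Fintype.card (Signs m) : ℝ) = 2 ^ Fintype.card (Bits (Fin m)) := by
      rw [Fintype.card_fun]; simp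
    have hB : ∀ A ∈ F, ((B A).card : ℝ)
        ≤ 2 * Real.exp (-(ε ^ 2 * 2 ^ m / 8)) * Fintype.card (Signs m) := by
      intro A hA
      obtain ⟨D, rfl⟩ := hFD A hA
      have := card_abs_quad_sub_trace_gt_le D.reEffect_posSemidef D.one_sub_reEffect_posSemidef
        h0 h1
      rw [← hcard, card_bits] at this
      refine (le_trans (le_of_eq ?_) this).trans (le_of_eq (by ring))
      simp only [B, card_bits]
      rfl
    calc ((F.biUnion B).card : ℝ) ≤ ∑ A ∈ F, ((B A).card : ℝ) := by
          exact_mod_cast Finset.card_biUnion_le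
      _ ≤ F.card * (2 * Real.exp (-(ε ^ 2 * 2 ^ m / 8)) * Fintype.card (Signs m)) := by
          rw [← nsmul_eq_mul]
          exact Finset.sum_le_card_nsmul _ _ _ hB
      _ ≤ _ := by
          rw [mul_assoc (Nat.cast _ : ℝ)]
          gcongr

/-- The coefficient in the bound for the logarithm of the number of small distinguishers. -/
def entropyCoeff (G : GateSet) : ℝ :=
  1 + G.card + (maxArity G + 1) * (maxArity G + 2)

theorem two_mul_count_le (G : GateSet) {m s : ℕ} (hm : 1 ≤ m) (hs : 1 ≤ s) :
    2 * (((G.card * (m + (maxArity G * s + 1)) ^ maxArity G + 1) ^ s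
        * (m + (maxArity G * s + 1)) : ℕ) : ℝ) ≤ Real.exp (entropyCoeff G * s ^ 2 * m) := by
  push_cast
  set K : ℝ := (maxArity G : ℝ) with hK
  set g : ℝ := (G.card : ℝ) with hg
  set w : ℝ := (m : ℝ) + (K * s + 1) with hw
  have hm' : (1 : ℝ) ≤ m := by exact_mod_cast hm
  have hs' : (1 : ℝ) ≤ s := by exact_mod_cast hs
  have hK0 : 0 ≤ K := Nat.cast_nonneg _
  have hg0 : 0 ≤ g := Nat.cast_nonneg _
  have hw1 : 1 ≤ w := by nlinarith
  -- Bounding `w` by `exp w` is crude but enough: the exponent stays polynomial in `s` and `m`, to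
  -- be compared with `2 ^ m`.
  have hwe : w ≤ Real.exp w := by linarith [Real.add_one_le_exp w]
  have h1 : g * w ^ maxArity G + 1 ≤ Real.exp (g + K * w) := by
    calc g * w ^ maxArity G + 1 ≤ (g + 1) * w ^ maxArity G := by
          linarith [one_le_pow₀ (n := maxArity G) hw1]
      _ ≤ Real.exp g * Real.exp w ^ maxArity G := by
          gcongr
          exact Real.add_one_le_exp g
      _ = _ := by rw [← Real.exp_nat_mul, ← Real.exp_add]
  have h2 : (2 : ℝ) ≤ Real.exp 1 := by linarith [Real.add_one_le_exp 1]
  calc 2 * ((g * w ^ maxArity G + 1) ^ s * w)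
      ≤ Real.exp 1 * (Real.exp (g + K * w) ^ s * Real.exp w) := by gcongr
    _ = Real.exp (1 + (s * (g + K * w) + w)) := by
        rw [← Real.exp_nat_mul, ← Real.exp_add, ← Real.exp_add]
    _ ≤ _ := by
        refine Real.exp_le_exp.mpr ?_
        have hsm : (s : ℝ) ≤ s * m := le_mul_of_one_le_right (by linarith) hm'
        have hms : (m : ℝ) ≤ s * m := le_mul_of_one_le_left (by linarith) hs'
        have hwle : w ≤ (K + 2) * (s * m) := by nlinarith
        have hss : (s : ℝ) * m ≤ s ^ 2 * m := by nlinarith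
        have e1 : (1 : ℝ) ≤ s ^ 2 * m := by nlinarith
        have e2 : s * g ≤ g * (s ^ 2 * m) := by nlinarith
        have e3 : s * (K * w) ≤ K * (K + 2) * (s ^ 2 * m) := by
          have := mul_le_mul_of_nonneg_left hwle (by positivity : 0 ≤ s * K)
          nlinarith
        have e4 : w ≤ (K + 2) * (s ^ 2 * m) := by nlinarith
        unfold entropyCoeff
        nlinarith

theorem exists_forall_sq_le_two_pow (R : ℝ) :
    ∃ m₀ : ℕ, ∀ m : ℕ, m₀ ≤ m → (16 * R * m) ^ 2 ≤ (2 : ℝ) ^ m := by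
  have h := (tendsto_pow_const_div_const_pow_of_one_lt 2 (one_lt_two : (1 : ℝ) < 2)).const_mul
    ((16 * R) ^ 2)
  rw [mul_zero] at h
  obtain ⟨m₀, hm₀⟩ := Filter.eventually_atTop.mp (h.eventually (gt_mem_nhds one_pos))
  refine ⟨m₀, fun m hm => ?_⟩
  have := hm₀ m hm
  rw [← mul_div_assoc, div_lt_one (by positivity)] at this
  rw [mul_pow]
  exact this.le

/-- Keeps `log₂ (s / ε)` away from `0` when `ε` is not too close to `1`, so that a large `C` forces
`m` to be large. -/
theorem one_sub_le_logb_div {s : ℕ} (hs : 1 ≤ s) {ε : ℝ} (h0 : 0 < ε) (h1 : ε ≤ 1) :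
    1 - ε ≤ Real.logb 2 (s / ε) := by
  have hs' : (1 : ℝ) ≤ s := by exact_mod_cast hs
  have h2 : Real.log 2 ≤ 1 := by linarith [Real.log_le_sub_one_of_pos (zero_lt_two' ℝ)]
  have h2' : 0 < Real.log 2 := Real.log_pos one_lt_two
  have h3 : 1 - ε ≤ Real.log (s / ε) := by
    rw [Real.log_div (by positivity) h0.ne']
    linarith [Real.log_le_sub_one_of_pos h0, Real.log_nonneg hs']
  rw [Real.logb, le_div_iff₀ h2']
  nlinarith

/-- Multiply `(s / ε)⁴ ≤ 2 ^ m` by `(16 R m)² ≤ 2 ^ m` and take square roots: one factor absorbs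
`s²/ε²`, the other the factor `m`. -/
theorem count_exponent_le {m s : ℕ} {ε R : ℝ} (h0 : 0 < ε)
    (hm : (16 * R * m) ^ 2 ≤ (2 : ℝ) ^ m) (hs : 4 * Real.logb 2 (s / ε) ≤ m) (hs1 : 1 ≤ s) :
    R * s ^ 2 * m ≤ ε ^ 2 * 2 ^ m / 16 := by
  have hs' : (0 : ℝ) < s := by exact_mod_cast hs1
  have h1 : (s / ε) ^ 4 ≤ (2 : ℝ) ^ m := by
    rw [← Real.rpow_natCast 2 m, ← Real.logb_le_iff_le_rpow one_lt_two (by positivity),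
      Real.logb_pow]
    exact_mod_cast hs
  rw [div_pow, div_le_iff₀ (by positivity)] at h1
  have h2 : (16 * R * m * s ^ 2) ^ 2 ≤ (ε ^ 2 * 2 ^ m) ^ 2 := by
    calc (16 * R * m * s ^ 2) ^ 2 = (16 * R * m) ^ 2 * s ^ 4 := by ring
      _ ≤ 2 ^ m * (2 ^ m * ε ^ 4) := by gcongr
      _ = _ := by ring
  have h3 := abs_le_of_sq_le_sq h2 (by positivity)
  linarith [h3, le_abs_self (16 * R * m * s ^ 2)]

end QCircuit

theorem mainTheorem8 (G : QCircuit.GateSet) :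
    ∃ C c : ℝ, 0 < C ∧ 0 < c ∧
      ∀ (s : ℕ) (ε : ℝ), 0 < ε →
        ∀ m : ℕ, C * Real.logb 2 ((s : ℝ) / ε) ≤ (m : ℝ) →
          1 - (2 : ℝ) ^ (-(c * ε ^ 2 * (2 : ℝ) ^ m)) ≤
            QCircuit.signProb fun z : QCircuit.Signs m =>
              QCircuit.IsPureState (QCircuit.ketbra (QCircuit.signVector z)) ∧
                QCircuit.Pseudorandom G s ε (QCircuit.ketbra (QCircuit.signVector z)) := by
  obtain ⟨m₀, hm₀⟩ := QCircuit.exists_forall_sq_le_two_pow (QCircuit.entropyCoeff G)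
  -- The summand `4` gives `(s / ε)⁴ ≤ 2 ^ m`; the summand `m₀ 2 ^ m₀` forces `m ≥ m₀`. The value `1
  -- / 16` is what remains of the tail exponent `1 / 8` after the union bound.
  refine ⟨4 + m₀ * 2 ^ m₀, 1 / 16, by positivity, by norm_num, fun s ε hε m hm => ?_⟩
  have hpos : (0 : ℝ) < (2 : ℝ) ^ (-(1 / 16 * ε ^ 2 * (2 : ℝ) ^ m)) := by positivity
  -- For `s = 0` the convention `Real.logb 2 0 = 0` makes the hypothesis on `m` vacuous, so every
  -- `m` has to be handled.
  rcases Nat.eq_zero_or_pos s with rfl | hs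
  · have h : ∀ z : QCircuit.Signs m,
        QCircuit.Pseudorandom G 0 ε (QCircuit.ketbra (QCircuit.signVector z)) := fun z D hD => by
      rw [D.abs_acceptProb_sub, D.quad_reEffect_of_size_eq_zero (Nat.le_zero.mp hD), sub_self,
        abs_zero, mul_zero]
      exact hε.le
    rw [QCircuit.signProb_eq_one fun z => ⟨QCircuit.isPureState_ketbra_signVector z, h z⟩]
    linarith
  -- For such `ε` every sign vector works. Otherwise `log₂ (s / ε) ≥ 1 - ε > 2⁻ᵐ`, which excludes
  -- the small `m` that the hypothesis would allow for `ε` near `1`.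
  by_cases hlarge : 1 - ((2 : ℝ) ^ m)⁻¹ ≤ ε
  · rw [QCircuit.signProb_eq_one fun z => ⟨QCircuit.isPureState_ketbra_signVector z,
      fun D _ => (D.abs_acceptProb_sub_le z).trans hlarge⟩]
    linarith
  rw [not_le] at hlarge
  have hinv : (0 : ℝ) < ((2 : ℝ) ^ m)⁻¹ := by positivity
  have hε1 : ε ≤ 1 := by linarith
  have hlog := QCircuit.one_sub_le_logb_div hs hε hε1
  have hlog0 : 0 ≤ Real.logb 2 (s / ε) := by linarith
  have hmul : 0 ≤ (m₀ : ℝ) * 2 ^ m₀ * Real.logb 2 (s / ε) := by positivity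
  have hm1 : 1 ≤ m := by
    rcases Nat.eq_zero_or_pos m with rfl | h
    · norm_num at hlarge
      linarith
    · exact h
  have hmm₀ : m₀ ≤ m := by
    by_contra hlt
    rw [not_le] at hlt
    -- This gives `m 2 ^ m ≥ 4 + m₀ 2 ^ m₀`, impossible for `m < m₀`.
    have h1 : (4 + m₀ * 2 ^ m₀) * ((2 : ℝ) ^ m)⁻¹ ≤ m :=
      le_trans (by gcongr; linarith) hm
    rw [mul_inv_le_iff₀ (by positivity)] at h1
    have h2 : (m : ℝ) * 2 ^ m ≤ m₀ * 2 ^ m₀ := by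
      gcongr
      exact one_le_two
    linarith
  have hexp := QCircuit.count_exponent_le hε (hm₀ m hmm₀) (by linarith) hs
  have hcount := QCircuit.two_mul_count_le G hm1 hs
  obtain ⟨S, hS, hcard⟩ := QCircuit.exists_finset_distinguished G m s hε hε1
  refine QCircuit.one_sub_le_signProb S (fun z hz => hS z fun h =>
    hz ⟨QCircuit.isPureState_ketbra_signVector z, h⟩) (hcard.trans ?_)
  refine mul_le_mul_of_nonneg_right ?_ (Nat.cast_nonneg _)
  rw [← mul_assoc, mul_comm _ (2 : ℝ)]
  refine (mul_le_mul_of_nonneg_right hcount (Real.exp_pos _).le).trans ?_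
  rw [← Real.exp_add, Real.rpow_def_of_pos two_pos]
  refine Real.exp_le_exp.mpr ?_
  -- The count costs at most `ε² 2 ^ m / 16` of the exponent `ε² 2 ^ m / 8`; passing from base `e`
  -- to base `2` only weakens the bound.
  have hlog2 : Real.log 2 ≤ 1 := by linarith [Real.log_le_sub_one_of_pos (zero_lt_two' ℝ)]
  have hN : 0 ≤ ε ^ 2 * (2 : ℝ) ^ m := by positivity
  nlinarith
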